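/- Let $\Omega\subset\mathbb R^n$, $D\subset\mathbb R^m$ be open (for instance domains), let $\|\cdot\|$ be the Euclidean norm, and let $f:\Omega\times D\to\mathbb R^n$ be real analytic. Let $D_1\subset D$ be open, assume $f(\Omega\times D_1)\subset\Omega$, and write $f^k(\cdot,\alpha)$ for the $k$-th iterate of $f(\cdot,\alpha):\Omega\to\Omega$. Let $\varphi:D_1\to\Omega$ be an analytic path of asymptotically stable steady states: $\varphi$ is real analytic and, for every $\alpha\in D_1$, $f(\varphi(\alpha),\alpha)=\varphi(\alpha)$; for every $\varepsilon>0$ there is $\delta>0$ such that $x\in\Omega$, $\|x-\varphi(\alpha)\|<\delta$ imply $\|f^k(x,\alpha)-\varphi(\alpha)\|<\varepsilon$ for all $k\ge 0$; and there is $r>0$ such that $f^k(x,\alpha)\to\varphi(\alpha)$ as $k\to\infty$ for all $x\in\Omega$ with $\|x-\varphi(\alpha)\|<r$. Assume moreover that $\|\partial_x f(\varphi(\alpha),\alpha)\|<1$ (operator norm) for every $\alpha\in D_1$. For $\alpha\in D_1$ let $$DA(\varphi(\alpha))=\{x\in\Omega : f^k(x,\alpha)\to\varphi(\alpha)\text{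 as }k\to\infty\},$$ $$G=\bigcup_{\alpha\in D_1}DA(\varphi(\alpha))\times\{\alpha\},\qquad V(x,\alpha)=\sum_{k=0}^\infty\|f^k(x,\alpha)-\varphi(\alpha)\|^2 .$$ Then $G$ is an open subset of $\Omega\times D$, the series converges at every point of $G$, $V$ is non-negative and real analytic on $G$, and: a. $(\varphi(\alpha),\alpha)\in G$ for every $\alpha\in D_1$. b. For every $(x,\alpha)\in G$ one has $(f(x,\alpha),\alpha)\in G$ and $V(f(x,\alpha),\alpha)-V(x,\alpha)=-\|x-\varphi(\alpha)\|^2$; and $V(\varphi(\alpha),\alpha)=0$ for every $\alpha\in D_1$. c. For every $\alpha\in D_1$, $DA(\varphi(\alpha))$ is the natural domain of analyticity in $\Omega$ of $V(\cdot,\alpha)$: it is open, $V(\cdot,\alpha)$ is real analytic on it, and whenever $U_2\subset\Omega$ is open and connected, $v$ is real analytic on $U_2$, and $v=V(\cdot,\alpha)$ on some non-empty open set $U_1\subset U_2\cap DA(\varphi(\alpha))$, then $U_2\subset DA(\varphi(\alpha))$. d. For every $\alpha\in D_1$ and every point $x^0\in\Omega$ of the boundary of $DA(\varphi(\alpha))$,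 $V(x,\alpha)\to+\infty$ as $x\to x^0$, $x\in DA(\varphi(\alpha))$. -/

import Mathlib

open Set Filter Topology

namespace ControlSystem

/-- State space (and parameter space): real coordinate space with the Euclidean norm. -/
abbrev E (n : ℕ) : Type := EuclideanSpace ℝ (Fin n)

/-- The `k`-th iterate `f^k(x, α)` of `x ↦ f (x, α)` with the control parameter `α` frozen. -/
def iter {n m : ℕ} (f : E n × E m → E n) (α : E m) (k : ℕ) (x : E n) : E n :=
  (fun y => f (y, α))^[k] x

/-- `x₀ ∈ Ω` is a steady state for the control parameter `α`. -/
def IsSteadyState {n m : ℕ} (Ω : Set (E n)) (f : E n × E m → E n) (α : E m) (x₀ : E n) : Prop :=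
  x₀ ∈ Ω ∧ f (x₀, α) = x₀

/-- Stability; the balls are balls of `Ω`. -/
def IsStable {n m : ℕ} (Ω : Set (E n)) (f : E n × E m → E n) (α : E m) (x₀ : E n) : Prop :=
  ∀ ε > 0, ∃ δ > 0, ∀ x ∈ Ω ∩ Metric.ball x₀ δ, ∀ k : ℕ, iter f α k x ∈ Ω ∩ Metric.ball x₀ ε

/-- Asymptotic stability of a steady state. -/
def IsAsymptoticallyStable {n m : ℕ} (Ω : Set (E n)) (f : E n × E m → E n) (α : E m)
    (x₀ : E n) : Prop :=
  IsSteadyState Ω f α x₀ ∧ IsStable Ω f α x₀ ∧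
    ∃ r > 0, ∀ x ∈ Ω ∩ Metric.ball x₀ r, Tendsto (fun k : ℕ => iter f α k x) atTop (𝓝 x₀)

/-- The domain of attraction `DA(x₀)` for the control parameter `α`. -/
def DA {n m : ℕ} (Ω : Set (E n)) (f : E n × E m → E n) (α : E m) (x₀ : E n) : Set (E n) :=
  {x | x ∈ Ω ∧ Tendsto (fun k : ℕ => iter f α k x) atTop (𝓝 x₀)}

/-- `φ` is an analytic path, defined on `D₁`, of asymptotically stable steady states. -/
def IsStablePath {n m : ℕ} (Ω : Set (E n)) (D₁ : Set (E m)) (f : E n × E m → E n)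
    (φ : E m → E n) : Prop :=
  AnalyticOnNhd ℝ φ D₁ ∧ ∀ α ∈ D₁, IsAsymptoticallyStable Ω f α (φ α)

/-- The union over `α ∈ D₁` of the sets `DA(φ(α)) × {α}`. -/
def G {n m : ℕ} (Ω : Set (E n)) (D₁ : Set (E m)) (f : E n × E m → E n) (φ : E m → E n) :
    Set (E n × E m) :=
  ⋃ α ∈ D₁, DA Ω f α (φ α) ×ˢ {α}

/-- The function `V(x, α) = ∑ₖ ‖f^k(x, α) - φ(α)‖²`. -/
noncomputable def V {n m : ℕ} (f : E n × E m → E n) (φ : E m → E n) (p : E n × E m) : ℝ :=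
  ∑' k : ℕ, ‖iter f p.2 k p.1 - φ p.2‖ ^ 2

/-- `U` is the natural domain of analyticity, inside the ambient open set `Ω`, of the real function
`u` (only the values of `u` on `U` matter): `u` is analytic on the open set `U ⊆ Ω`, and no
restriction of `u` to a nonempty open subset `U₁` of `U` continues analytically to a connected open
subset `U₂` of `Ω` that contains `U₁` and is not contained in `U`. -/
def IsNaturalDomain {n : ℕ} (Ω U : Set (E n)) (u : E n → ℝ) : Prop :=
  IsOpen U ∧ U ⊆ Ω ∧ AnalyticOnNhd ℝ u U ∧
    ∀ (U₁ U₂ : Set (E n)) (v : E n → ℝ), IsOpen U₁ → U₁.Nonempty → U₁ ⊆ U₂ ∩ U →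
      IsOpen U₂ → IsConnected U₂ → U₂ ⊆ Ω → AnalyticOnNhd ℝ v U₂ → EqOn v u U₁ → U₂ ⊆ U

end ControlSystem

/-!
Near `(φ α, α)` the shifted orbit `u = (fᵏ(x, α) - φ α)ₖ` is the solution in `ℓ²` of the equation
`u = (x - φ α, 0, 0, …) + shift ((f (φ α + uₖ, α) - f (φ α, α))ₖ)`. The superposition operator on
the right is analytic, because each homogeneous term of the power series of `f` acts boundedly on
`ℓ²`, and the linearization in `u` at `u = 0` is `1 - shift ∘ A` with `A = ∂ₓf (φ α, α)` acting
termwise; it is invertible since `‖A‖ < 1`. By the analytic implicit function theorem `u` is an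
analytic function of `(x, α)`, hence so is `V = ‖u‖²`. Every orbit in `G` enters this neighbourhood,
and `V` is a finite sum plus `V` along the orbit, so that `V` is analytic on all of `G`.

An orbit starting outside the domain of attraction never enters a fixed ball around `φ α`, so the
partial sums of `V` at such a point are unbounded. By continuity `V` tends to infinity there, which
prevents any analytic continuation of `V` beyond the domain of attraction.
-/

namespace ControlSystem

open scoped ENNReal ContDiff

section SequenceSpace

variable {𝕜 X F ι : Type*} [NontriviallyNormedField 𝕜] [NormedAddCommGroup X]
  [NormedAddCommGroup F] {p : ℝ≥0∞} [Fact (1 ≤ p)]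

theorem norm_lp_le_of_forall_le {x : lp (fun _ : ι => F) p} {g : lp (fun _ : ι => ℝ) p}
    (h : ∀ k, ‖x k‖ ≤ g k) : ‖x‖ ≤ ‖g‖ :=
  lp.norm_mono (one_pos.trans_le Fact.out).ne' fun k => (h k).trans (le_abs_self _)

theorem memℓp_shift (s : lp (fun _ : ℕ => X) p) :
    Memℓp (fun k : ℕ => (k.casesOn 0 s : X)) p := by
  obtain rfl | rfl | hp := p.trichotomy
  · exact absurd (Fact.out : (1 : ℝ≥0∞) ≤ 0) (by simp)
  · refine memℓp_infty ⟨‖s‖, forall_mem_range.2 fun k => ?_⟩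
    cases k with
    | zero => simp
    | succ k => exact lp.norm_apply_le_norm ENNReal.top_ne_zero s k
  · exact memℓp_gen ((summable_nat_add_iff 1).1 ((lp.memℓp s).summable hp))

theorem norm_shift_le (s : lp (fun _ : ℕ => X) p) :
    ‖(⟨_, memℓp_shift s⟩ : lp (fun _ : ℕ => X) p)‖ ≤ ‖s‖ := by
  obtain rfl | rfl | hp := p.trichotomy
  · exact absurd (Fact.out : (1 : ℝ≥0∞) ≤ 0) (by simp)
  · refine lp.norm_le_of_forall_le (norm_nonneg s) fun k => ?_
    cases k with
    | zero => simp
    | succ k => exact lp.norm_apply_le_norm ENNReal.top_ne_zero s k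
  · refine lp.norm_le_of_tsum_le hp (norm_nonneg s) (le_of_eq ?_)
    rw [((memℓp_shift s).summable hp).tsum_eq_zero_add, lp.norm_rpow_eq_tsum hp s]
    simp [Real.zero_rpow hp.ne']

variable [NormedSpace 𝕜 X] [NormedSpace 𝕜 F]

/-- The operator `(sₖ) ↦ (A sₖ)` on `ℓᵖ` induced by a continuous linear map `A`. -/
noncomputable def lpMap (A : X →L[𝕜] F) : lp (fun _ : ι => X) p →L[𝕜] lp (fun _ : ι => F) p :=
  LinearMap.mkContinuous
    { toFun := fun s => ⟨fun k => A (s k),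
        (lp.memℓp (‖A‖ • lp.toNorm s)).mono fun k => A.le_opNorm (s k)⟩
      map_add' := fun s t => lp.ext (funext fun k => A.map_add (s k) (t k))
      map_smul' := fun a s => lp.ext (funext fun k => A.map_smul a (s k)) }
    ‖A‖ fun s =>
      (norm_lp_le_of_forall_le (g := ‖A‖ • lp.toNorm s) fun k => A.le_opNorm (s k)).trans
        (by rw [norm_smul, norm_norm, lp.norm_toNorm])

@[simp]
theorem lpMap_apply (A : X →L[𝕜] F) (s : lp (fun _ : ι => X) p) (k : ι) :
    lpMap A s k = A (s k) := rfl

theorem norm_lpMap_le (A : X →L[𝕜] F) : ‖lpMap (ι := ι) (p := p) A‖ ≤ ‖A‖ :=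
  LinearMap.mkContinuous_norm_le _ (norm_nonneg A) _

variable (𝕜 X p) in
/-- The right shift `(s₀, s₁, …) ↦ (0, s₀, s₁, …)` on `ℓᵖ`. -/
noncomputable def lpShift : lp (fun _ : ℕ => X) p →L[𝕜] lp (fun _ : ℕ => X) p :=
  LinearMap.mkContinuous
    { toFun := fun s => ⟨_, memℓp_shift s⟩
      map_add' := fun s t => lp.ext <| funext fun k => by
        cases k <;> [exact (add_zero _).symm; rfl]
      map_smul' := fun a s => lp.ext <| funext fun k => by
        cases k <;> [exact (smul_zero _).symm; rfl] }
    1 fun s => by simpa using norm_shift_le s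

@[simp]
theorem lpShift_apply_zero (s : lp (fun _ : ℕ => X) p) : lpShift 𝕜 X p s 0 = 0 := rfl

@[simp]
theorem lpShift_apply_succ (s : lp (fun _ : ℕ => X) p) (k : ℕ) :
    lpShift 𝕜 X p s (k + 1) = s k := rfl

theorem norm_lpShift_le : ‖lpShift 𝕜 X p‖ ≤ 1 :=
  LinearMap.mkContinuous_norm_le _ zero_le_one _

end SequenceSpace

section Superposition

variable {𝕜 X F ι κ : Type*} [NormedAddCommGroup X] [NormedAddCommGroup F] {f : X → F}
  {p : ℝ≥0∞}

open scoped Classical in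
/-- The superposition (Nemytskii) operator `(s, b) ↦ (f (b + sₖ) - f b)ₖ` on `ℓᵖ × X`, with the
junk value `0` where the increments do not form a sequence in `ℓᵖ`. -/
noncomputable def superposition (f : X → F) (q : lp (fun _ : ι => X) p × X) :
    lp (fun _ : ι => F) p :=
  if h : Memℓp (fun k => f (q.2 + q.1 k) - f q.2) p then ⟨_, h⟩ else 0

theorem superposition_eq_of_forall {q : lp (fun _ : ι => X) p × X} {u : lp (fun _ : ι => F) p}
    (h : ∀ k, u k = f (q.2 + q.1 k) - f q.2) : superposition f q = u := by
  have hu : Memℓp (fun k => f (q.2 + q.1 k) - f q.2) p := funext h ▸ lp.memℓp u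
  rw [superposition, dif_pos hu]
  exact lp.ext (funext fun k => (h k).symm)

variable [NontriviallyNormedField 𝕜] [NormedSpace 𝕜 X] [NormedSpace 𝕜 F]
  [Fintype κ] [DecidableEq κ] [Fact (1 ≤ p)]

theorem norm_multilinear_add_sub_le
    (q : ContinuousMultilinearMap 𝕜 (fun _ : κ => X) F) {b s : κ → X} {M : κ → ℝ}
    (hb : ∀ i, ‖b i‖ ≤ M i) (hs : ∀ i, ‖s i‖ ≤ M i) :
    ‖q (b + s) - q b‖ ≤ ‖q‖ * ∑ i, (∏ j ∈ Finset.univ.erase i, 2 * M j) * ‖s i‖ := by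
  refine (q.norm_image_sub_le' (b + s) b).trans ?_
  gcongr with i
  rw [← Finset.prod_erase_mul _ _ (Finset.mem_univ i), if_pos rfl, Pi.add_apply,
    add_sub_cancel_left]
  gcongr with j hj
  rw [if_neg (Finset.ne_of_mem_erase hj)]
  have hM : 0 ≤ M j := (norm_nonneg _).trans (hb j)
  refine max_le ((norm_add_le _ _).trans ?_) ?_ <;> linarith [hb j, hs j]

/-- A real sequence in `ℓᵖ` dominating the increments `q (b + sₖ) - q b`, where `v = (s, b)`. -/
noncomputable def incrementBound (q : ContinuousMultilinearMap 𝕜 (fun _ : κ => X) F)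
    (v : κ → lp (fun _ : ι => X) p × X) : lp (fun _ : ι => ℝ) p :=
  ‖q‖ • ∑ i, (∏ l ∈ Finset.univ.erase i, 2 * ‖v l‖) • lp.toNorm (v i).1

theorem norm_increment_le (q : ContinuousMultilinearMap 𝕜 (fun _ : κ => X) F)
    (v : κ → lp (fun _ : ι => X) p × X) (k : ι) :
    ‖q (fun i => (v i).2 + (v i).1 k) - q (fun i => (v i).2)‖ ≤ incrementBound q v k :=
  calc _ ≤ ‖q‖ * ∑ i, (∏ l ∈ Finset.univ.erase i, 2 * ‖v l‖) * ‖(v i).1 k‖ :=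
        norm_multilinear_add_sub_le q (fun i => norm_snd_le (v i)) fun i =>
          (lp.norm_apply_le_norm (one_pos.trans_le Fact.out).ne' _ k).trans (norm_fst_le (v i))
    _ = incrementBound q v k :=
        congrArg (‖q‖ * ·) ((map_sum (lp.evalCLM ℝ (fun _ : ι => ℝ) p k)
          (fun i => (∏ l ∈ Finset.univ.erase i, 2 * ‖v l‖) • lp.toNorm (v i).1) _).symm)

theorem norm_incrementBound_le (q : ContinuousMultilinearMap 𝕜 (fun _ : κ => X) F)
    (v : κ → lp (fun _ : ι => X) p × X) :
    ‖incrementBound q v‖ ≤ 4 ^ Fintype.card κ * ‖q‖ * ∏ i, ‖v i‖ := by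
  have hterm : ∀ i, ‖(∏ l ∈ Finset.univ.erase i, 2 * ‖v l‖) • lp.toNorm (v i).1‖ ≤
      ∏ l, 2 * ‖v l‖ := fun i => by
    rw [norm_smul, lp.norm_toNorm, Real.norm_of_nonneg (by positivity),
      ← Finset.prod_erase_mul _ _ (Finset.mem_univ i)]
    gcongr
    linarith [norm_fst_le (v i), norm_nonneg (v i)]
  have hcard : (Fintype.card κ : ℝ) ≤ 2 ^ Fintype.card κ := by
    exact_mod_cast Nat.lt_two_pow_self.le
  calc ‖incrementBound q v‖ ≤ ‖q‖ * ∑ _i : κ, ∏ l, 2 * ‖v l‖ := by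
        rw [incrementBound, norm_smul, norm_norm]
        gcongr
        exact norm_sum_le_of_le _ fun i _ => hterm i
    _ = Fintype.card κ * 2 ^ Fintype.card κ * ‖q‖ * ∏ i, ‖v i‖ := by
        simp only [Finset.sum_const, Finset.card_univ, nsmul_eq_mul, Finset.prod_mul_distrib,
          Finset.prod_const]
        ring
    _ ≤ 2 ^ Fintype.card κ * 2 ^ Fintype.card κ * ‖q‖ * ∏ i, ‖v i‖ := by gcongr
    _ = 4 ^ Fintype.card κ * ‖q‖ * ∏ i, ‖v i‖ := by rw [← mul_pow]; norm_num

/-- The multilinear map `(s, b) ↦ q (b + sₖ) - q b`. -/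
noncomputable def incrementCoord (q : ContinuousMultilinearMap 𝕜 (fun _ : κ => X) F) (k : ι) :
    ContinuousMultilinearMap 𝕜 (fun _ : κ => lp (fun _ : ι => X) p × X) F :=
  q.compContinuousLinearMap (fun _ => .snd 𝕜 _ X + (lp.evalCLM 𝕜 _ p k).comp (.fst 𝕜 _ X)) -
    q.compContinuousLinearMap fun _ => .snd 𝕜 _ X

/-- The `ℓᵖ`-valued multilinear map `(s, b) ↦ (q (b + sₖ) - q b)ₖ`. -/
noncomputable def incrementMultilinear (q : ContinuousMultilinearMap 𝕜 (fun _ : κ => X) F) :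
    ContinuousMultilinearMap 𝕜 (fun _ : κ => lp (fun _ : ι => X) p × X) (lp (fun _ : ι => F) p) :=
  MultilinearMap.mkContinuous
    { toFun := fun v => ⟨fun k => incrementCoord q k v,
        (lp.memℓp (incrementBound q v)).mono (norm_increment_le q v)⟩
      map_update_add' := fun v i x y =>
        lp.ext (funext fun k => (incrementCoord q k).map_update_add v i x y)
      map_update_smul' := fun v i a x =>
        lp.ext (funext fun k => (incrementCoord q k).map_update_smul v i a x) }
    (4 ^ Fintype.card κ * ‖q‖) fun v =>
      (norm_lp_le_of_forall_le (norm_increment_le q v)).trans (norm_incrementBound_le q v)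

theorem incrementMultilinear_apply (q : ContinuousMultilinearMap 𝕜 (fun _ : κ => X) F)
    (v : κ → lp (fun _ : ι => X) p × X) (k : ι) :
    incrementMultilinear q v k = q (fun i => (v i).2 + (v i).1 k) - q (fun i => (v i).2) := rfl

theorem norm_incrementMultilinear_le (q : ContinuousMultilinearMap 𝕜 (fun _ : κ => X) F) :
    ‖incrementMultilinear (ι := ι) (p := p) q‖ ≤ 4 ^ Fintype.card κ * ‖q‖ :=
  MultilinearMap.mkContinuous_norm_le _ (by positivity) _

/-- If `P` is the power series of `f` at `b₀`, this is the power series at `(0, b₀)` of the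
superposition operator `(s, b) ↦ (f (b + sₖ) - f b)ₖ` on `ℓᵖ × X`. -/
noncomputable def superpositionSeries (ι : Type*) (p : ℝ≥0∞) [Fact (1 ≤ p)]
    (P : FormalMultilinearSeries 𝕜 X F) :
    FormalMultilinearSeries 𝕜 (lp (fun _ : ι => X) p × X) (lp (fun _ : ι => F) p) :=
  fun j => incrementMultilinear (P j)

theorem radius_div_four_le_radius_superpositionSeries (P : FormalMultilinearSeries 𝕜 X F) :
    P.radius / 4 ≤ (superpositionSeries ι p P).radius := by
  refine ENNReal.le_of_forall_nnreal_lt fun r hr => ?_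
  have hr' : ((4 * r : NNReal) : ℝ≥0∞) < P.radius := by
    have h := (ENNReal.lt_div_iff_mul_lt (by simp) (by simp)).1 hr
    rwa [mul_comm] at h
  obtain ⟨C, -, hC⟩ := P.norm_mul_pow_le_of_lt_radius hr'
  refine FormalMultilinearSeries.le_radius_of_bound _ C fun j => ?_
  calc ‖superpositionSeries ι p P j‖ * (r : ℝ) ^ j
      ≤ 4 ^ j * ‖P j‖ * (r : ℝ) ^ j := by
        gcongr
        exact (norm_incrementMultilinear_le (P j)).trans_eq (by rw [Fintype.card_fin])
    _ = ‖P j‖ * ((4 * r : NNReal) : ℝ) ^ j := by push_cast; ring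
    _ ≤ C := hC j

variable {P : FormalMultilinearSeries 𝕜 X F} {b₀ : X} {r : ℝ≥0∞}

theorem hasSum_superpositionSeries_apply (hf : HasFPowerSeriesOnBall f P b₀ r)
    {y : lp (fun _ : ι => X) p × X} (hy : y ∈ Metric.eball 0 (r / 4)) (k : ι) :
    HasSum (fun j => superpositionSeries ι p P j (fun _ => y) k)
      (f (b₀ + y.2 + y.1 k) - f (b₀ + y.2)) := by
  have hy4 : 4 * ‖y‖ₑ < r := by
    rw [Metric.mem_eball, edist_zero_right] at hy
    have h := (ENNReal.lt_div_iff_mul_lt (by simp) (by simp)).1 hy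
    rwa [mul_comm] at h
  have h1 : ‖y.1 k‖ₑ ≤ ‖y‖ₑ := by
    rw [enorm_le_iff_norm_le]
    exact (lp.norm_apply_le_norm (one_pos.trans_le Fact.out).ne' _ k).trans (norm_fst_le y)
  have h2 : ‖y.2‖ₑ ≤ ‖y‖ₑ := enorm_le_iff_norm_le.2 (norm_snd_le y)
  have hmem : ∀ z : X, ‖z‖ₑ ≤ 2 * ‖y‖ₑ → z ∈ Metric.eball 0 r := fun z hz => by
    rw [Metric.mem_eball, edist_zero_right]
    refine (hz.trans ?_).trans_lt hy4
    gcongr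
    norm_num
  rw [add_assoc]
  refine (hf.hasSum (hmem _ ?_)).sub (hf.hasSum (hmem _ ?_))
  · rw [two_mul]
    exact (enorm_add_le _ _).trans (add_le_add h2 h1)
  · exact h2.trans (le_mul_of_one_le_left' one_le_two)

theorem fderiv_apply_of_hasFPowerSeriesAt {x : X} (hf : HasFPowerSeriesAt f P x) (z : X) :
    fderiv 𝕜 f x z = P 1 fun _ => z := by
  rw [hf.fderiv_eq, continuousMultilinearCurryFin1_apply, Fin.snoc_zero]

variable [CompleteSpace F]

theorem superpositionSeries_sum_apply (hf : HasFPowerSeriesOnBall f P b₀ r)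
    {q : lp (fun _ : ι => X) p × X} (hq : q ∈ Metric.eball (0, b₀) (r / 4)) (k : ι) :
    (superpositionSeries ι p P).sum (q - (0, b₀)) k = f (q.2 + q.1 k) - f q.2 := by
  have hy : q - (0, b₀) ∈ Metric.eball 0 (r / 4) := by
    rwa [Metric.mem_eball, edist_zero_right, ← edist_eq_enorm_sub]
  have hy' : q - (0, b₀) ∈ Metric.eball 0 (superpositionSeries ι p P).radius :=
    Metric.eball_subset_eball
      ((ENNReal.div_le_div_right hf.r_le 4).trans
        (radius_div_four_le_radius_superpositionSeries P)) hy
  have h := (((superpositionSeries ι p P).hasSum hy').mapL (lp.evalCLM 𝕜 _ p k)).unique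
    (hasSum_superpositionSeries_apply hf hy k)
  simpa using! h

theorem hasFPowerSeriesOnBall_superposition (hf : HasFPowerSeriesOnBall f P b₀ r) :
    HasFPowerSeriesOnBall (superposition f) (superpositionSeries ι p P) (0, b₀) (r / 4) := by
  have hr : 0 < r / 4 := ENNReal.div_pos hf.r_pos.ne' (by simp)
  have hR : r / 4 ≤ (superpositionSeries ι p P).radius :=
    (ENNReal.div_le_div_right hf.r_le 4).trans (radius_div_four_le_radius_superpositionSeries P)
  have h := ((superpositionSeries ι p P).hasFPowerSeriesOnBall (hr.trans_le hR)).mono hr hR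
  exact .congr (by simpa using h.comp_sub (0, b₀)) fun q hq =>
    (superposition_eq_of_forall (superpositionSeries_sum_apply hf hq)).symm

theorem eventually_superposition_apply (hf : AnalyticAt 𝕜 f b₀) :
    ∀ᶠ q in 𝓝 ((0 : lp (fun _ : ι => X) p), b₀), ∀ k,
      superposition f q k = f (q.2 + q.1 k) - f q.2 := by
  obtain ⟨P, r, hP⟩ := hf
  have hr : 0 < r / 4 := ENNReal.div_pos hP.r_pos.ne' (by simp)
  filter_upwards [Metric.eball_mem_nhds _ hr] with q hq k
  rw [superposition_eq_of_forall (superpositionSeries_sum_apply hP hq),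
    superpositionSeries_sum_apply hP hq]

theorem analyticAt_superposition (hf : AnalyticAt 𝕜 f b₀) :
    AnalyticAt 𝕜 (superposition f) ((0 : lp (fun _ : ι => X) p), b₀) :=
  let ⟨_, _, hP⟩ := hf
  (hasFPowerSeriesOnBall_superposition hP).analyticAt

theorem fderiv_superposition (hf : AnalyticAt 𝕜 f b₀) :
    fderiv 𝕜 (superposition f) ((0 : lp (fun _ : ι => X) p), b₀) =
      (lpMap (fderiv 𝕜 f b₀)).comp (.fst 𝕜 _ X) := by
  obtain ⟨P, r, hP⟩ := hf
  refine ContinuousLinearMap.ext fun q => lp.ext (funext fun k => ?_)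
  rw [fderiv_apply_of_hasFPowerSeriesAt (hasFPowerSeriesOnBall_superposition hP).hasFPowerSeriesAt,
    superpositionSeries, incrementMultilinear_apply,
    ← fderiv_apply_of_hasFPowerSeriesAt hP.hasFPowerSeriesAt,
    ← fderiv_apply_of_hasFPowerSeriesAt hP.hasFPowerSeriesAt]
  simp

end Superposition

section ImplicitOrbit

theorem fderiv_prodMk_right_eq {𝕜 X Y F : Type*} [NontriviallyNormedField 𝕜]
    [NormedAddCommGroup X] [NormedSpace 𝕜 X] [NormedAddCommGroup Y] [NormedSpace 𝕜 Y]
    [NormedAddCommGroup F] [NormedSpace 𝕜 F]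
    {f : X × Y → F} {x : X} {y : Y} (hf : DifferentiableAt 𝕜 f (x, y)) :
    fderiv 𝕜 (fun x => f (x, y)) x = (fderiv 𝕜 f (x, y)).comp (.inl 𝕜 X Y) :=
  (hf.hasFDerivAt.comp x (hasFDerivAt_prodMk_left x y)).fderiv

variable {𝕜 X Y : Type*} [RCLike 𝕜] [NormedAddCommGroup X] [NormedSpace 𝕜 X]
  [NormedAddCommGroup Y] [NormedSpace 𝕜 Y] {p : ℝ≥0∞} [Fact (1 ≤ p)]
  {f : X × Y → X} {φ : Y → X} {α₀ : Y}

variable (𝕜) in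
/-- The equation `orbitEquation 𝕜 f φ ((x, α), u) = 0` expresses that `u` is the orbit of `x` under
`f (·, α)`, seen from the fixed point `φ α`: it says `u₀ = x - φ α` and
`uₖ₊₁ = f (φ α + uₖ, α) - f (φ α, α)`. -/
noncomputable def orbitEquation (f : X × Y → X) (φ : Y → X)
    (w : (X × Y) × lp (fun _ : ℕ => X) p) : lp (fun _ : ℕ => X) p :=
  w.2 - lpShift 𝕜 X p (superposition f (lpMap (.inl 𝕜 X Y) w.2, (φ w.1.2, w.1.2))) -
    lp.singleContinuousLinearMap 𝕜 (fun _ => X) p 0 (w.1.1 - φ w.1.2)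

theorem eq_iterate_sub_of_orbitEquation_eq_zero {x : X} {α : Y} {u : lp (fun _ : ℕ => X) p}
    (hα : f (φ α, α) = φ α) (hu : orbitEquation 𝕜 f φ ((x, α), u) = 0)
    (hf : ∀ k, superposition f (lpMap (.inl 𝕜 X Y) u, (φ α, α)) k =
      f ((φ α, α) + lpMap (p := p) (.inl 𝕜 X Y) u k) - f (φ α, α)) (k : ℕ) :
    u k = (fun y => f (y, α))^[k] x - φ α := by
  have hu' : u = lpShift 𝕜 X p (superposition f (lpMap (.inl 𝕜 X Y) u, (φ α, α))) +
      lp.single p 0 (x - φ α) := by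
    rw [← sub_eq_iff_eq_add', ← sub_eq_zero]
    exact hu
  induction k with
  | zero => simpa using congrArg (· 0) hu'
  | succ k ih =>
    have hk : u (k + 1) = f (φ α + u k, α) - φ α := by
      simpa [hf, hα] using congrArg (· (k + 1)) hu'
    rw [hk, ih, add_sub_cancel, Function.iterate_succ_apply']

variable [CompleteSpace X]

theorem analyticAt_orbitEquation (hf : AnalyticAt 𝕜 f (φ α₀, α₀)) (hφ : AnalyticAt 𝕜 φ α₀) :
    AnalyticAt 𝕜 (orbitEquation (p := p) 𝕜 f φ) ((φ α₀, α₀), 0) := by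
  have hα : AnalyticAt 𝕜 (fun w : (X × Y) × lp (fun _ : ℕ => X) p => w.1.2) ((φ α₀, α₀), 0) :=
    analyticAt_snd.fun_comp analyticAt_fst
  have hφ' : AnalyticAt 𝕜 (fun w : (X × Y) × lp (fun _ : ℕ => X) p => φ w.1.2)
      ((φ α₀, α₀), 0) := hφ.fun_comp_of_eq hα rfl
  have hu : AnalyticAt 𝕜 (fun w : (X × Y) × lp (fun _ : ℕ => X) p => lpMap (.inl 𝕜 X Y) w.2)
      ((φ α₀, α₀), 0) := ((lpMap (.inl 𝕜 X Y)).analyticAt _).fun_comp analyticAt_snd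
  have hsup : AnalyticAt 𝕜 (fun w : (X × Y) × lp (fun _ : ℕ => X) p =>
      superposition f (lpMap (.inl 𝕜 X Y) w.2, (φ w.1.2, w.1.2))) ((φ α₀, α₀), 0) :=
    (analyticAt_superposition hf).fun_comp_of_eq (hu.prod (hφ'.prod hα)) (by simp)
  exact (analyticAt_snd.sub (((lpShift 𝕜 X p).analyticAt _).fun_comp hsup)).sub
    (((lp.singleContinuousLinearMap 𝕜 (fun _ : ℕ => X) p 0).analyticAt _).fun_comp
      ((analyticAt_fst.fun_comp analyticAt_fst).sub hφ'))

theorem fderiv_orbitEquation_comp_inr (hf : AnalyticAt 𝕜 f (φ α₀, α₀)) (hφ : AnalyticAt 𝕜 φ α₀) :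
    (fderiv 𝕜 (orbitEquation (p := p) 𝕜 f φ) ((φ α₀, α₀), 0)).comp (.inr 𝕜 _ _) =
      1 - (lpShift 𝕜 X p).comp (lpMap (fderiv 𝕜 (fun x => f (x, α₀)) (φ α₀))) := by
  have hH := (analyticAt_orbitEquation (p := p) hf hφ).differentiableAt.hasFDerivAt.comp 0
    (hasFDerivAt_prodMk_right (φ α₀, α₀) 0)
  have hN : HasFDerivAt (superposition f)
      ((lpMap (p := p) (fderiv 𝕜 f (φ α₀, α₀))).comp (.fst 𝕜 _ (X × Y)))
      (lpMap (.inl 𝕜 X Y) (0 : lp (fun _ : ℕ => X) p), (φ α₀, α₀)) := by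
    rw [map_zero, ← fderiv_superposition hf]
    exact (analyticAt_superposition hf).differentiableAt.hasFDerivAt
  have hu : HasFDerivAt (fun u : lp (fun _ : ℕ => X) p => (lpMap (.inl 𝕜 X Y) u, (φ α₀, α₀)))
      _ 0 := (lpMap (.inl 𝕜 X Y)).hasFDerivAt.prodMk (hasFDerivAt_const _ _)
  have hS := ((hasFDerivAt_id 0).sub ((lpShift 𝕜 X p).hasFDerivAt.comp 0 (hN.comp 0 hu))).sub_const
    (lp.singleContinuousLinearMap 𝕜 (fun _ => X) p 0 (φ α₀ - φ α₀))
  refine (hH.unique hS).trans ?_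
  rw [fderiv_prodMk_right_eq hf.differentiableAt]
  rfl

theorem isInvertible_fderiv_orbitEquation (hf : AnalyticAt 𝕜 f (φ α₀, α₀))
    (hφ : AnalyticAt 𝕜 φ α₀) (hcontr : ‖fderiv 𝕜 (fun x => f (x, α₀)) (φ α₀)‖ < 1) :
    ((fderiv 𝕜 (orbitEquation (p := p) 𝕜 f φ) ((φ α₀, α₀), 0)).comp
      (.inr 𝕜 _ _)).IsInvertible := by
  set A := fderiv 𝕜 (fun x => f (x, α₀)) (φ α₀)
  have hnorm : ‖(lpShift 𝕜 X p).comp (lpMap A)‖ < 1 :=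
    calc _ ≤ ‖lpShift 𝕜 X p‖ * ‖lpMap A‖ := ContinuousLinearMap.opNorm_comp_le _ _
      _ ≤ 1 * ‖A‖ := by
        gcongr
        exacts [norm_lpShift_le, norm_lpMap_le A]
      _ < 1 := by rwa [one_mul]
  rw [fderiv_orbitEquation_comp_inr hf hφ]
  exact ⟨ContinuousLinearEquiv.unitsEquiv 𝕜 _ (Units.oneSub _ hnorm), rfl⟩

theorem exists_analyticAt_iterate_sub [CompleteSpace Y] (hf : AnalyticAt 𝕜 f (φ α₀, α₀))
    (hφ : AnalyticAt 𝕜 φ α₀) (hfix : ∀ᶠ α in 𝓝 α₀, f (φ α, α) = φ α)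
    (hcontr : ‖fderiv 𝕜 (fun x => f (x, α₀)) (φ α₀)‖ < 1) :
    ∃ S : X × Y → lp (fun _ : ℕ => X) p, AnalyticAt 𝕜 S (φ α₀, α₀) ∧
      ∀ᶠ q in 𝓝 (φ α₀, α₀), ∀ k, S q k = (fun x => f (x, q.2))^[k] q.1 - φ q.2 := by
  have hH : ContDiffAt 𝕜 ω (orbitEquation (p := p) 𝕜 f φ) ((φ α₀, α₀), 0) :=
    (analyticAt_orbitEquation hf hφ).contDiffAt
  have hinv := isInvertible_fderiv_orbitEquation (p := p) hf hφ hcontr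
  have hn : (ω : WithTop ℕ∞) ≠ 0 := by simp
  set S := hH.implicitFunction hn hinv
  have hSa : AnalyticAt 𝕜 S (φ α₀, α₀) :=
    (hH.contDiffAt_implicitFunction hn hinv).analyticAt
  have hS0 : S (φ α₀, α₀) = 0 := hH.implicitFunction_apply_self hn hinv
  have hH0 : orbitEquation (p := p) 𝕜 f φ ((φ α₀, α₀), 0) = 0 := by
    have h0 : superposition f ((0 : lp (fun _ : ℕ => X × Y) p), (φ α₀, α₀)) = 0 :=
      superposition_eq_of_forall fun k => by simp
    simp [orbitEquation, h0]
  have hin : Tendsto (fun q : X × Y => (lpMap (.inl 𝕜 X Y) (S q), (φ q.2, q.2)))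
      (𝓝 (φ α₀, α₀)) (𝓝 (0, (φ α₀, α₀))) := by
    have hc : ContinuousAt (fun q : X × Y => (lpMap (.inl 𝕜 X Y) (S q), (φ q.2, q.2)))
      (φ α₀, α₀) := ((lpMap _).continuous.continuousAt.comp hSa.continuousAt).prodMk
        ((hφ.continuousAt.comp' continuousAt_snd).prodMk continuousAt_snd)
    simpa [ContinuousAt, hS0] using hc
  refine ⟨S, hSa, ?_⟩
  filter_upwards [hH.eventually_apply_implicitFunction hn hinv,
    hin.eventually (eventually_superposition_apply hf),
    continuousAt_snd.eventually hfix] with q hq hsup hfixq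
  exact eq_iterate_sub_of_orbitEquation_eq_zero hfixq (hq.trans hH0) hsup

end ImplicitOrbit

section Lyapunov

variable {X : Type*} {Ω : Set X} {g : X → X} {a x : X}

section Basin

variable [TopologicalSpace X]

/-- The domain of attraction in `Ω` of the point `a` under iteration of `g`. -/
def basin (Ω : Set X) (g : X → X) (a : X) : Set X :=
  {x | x ∈ Ω ∧ Tendsto (fun k : ℕ => g^[k] x) atTop (𝓝 a)}

theorem mem_basin_of_iterate_mem_basin (hx : x ∈ Ω) {k : ℕ} (h : g^[k] x ∈ basin Ω g a) :
    x ∈ basin Ω g a := by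
  refine ⟨hx, (tendsto_add_atTop_iff_nat k).1 ?_⟩
  simpa only [Function.iterate_add_apply] using h.2

theorem apply_mem_basin (hg : MapsTo g Ω Ω) (h : x ∈ basin Ω g a) : g x ∈ basin Ω g a :=
  ⟨hg h.1, (tendsto_add_atTop_iff_nat 1).2 h.2⟩

end Basin

variable [NormedAddCommGroup X]

/-- The series `∑ₖ ‖gᵏ x - a‖²`, a Lyapunov function for the attractor `a` of `g`, with the junk
value `0` where it diverges. -/
noncomputable def lyapunov (g : X → X) (a x : X) : ℝ :=
  ∑' k : ℕ, ‖g^[k] x - a‖ ^ 2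

theorem mem_basin_of_summable (hx : x ∈ Ω) (h : Summable fun k : ℕ => ‖g^[k] x - a‖ ^ 2) :
    x ∈ basin Ω g a := by
  refine ⟨hx, tendsto_iff_norm_sub_tendsto_zero.2 ?_⟩
  simpa [Real.sqrt_sq] using h.tendsto_atTop_zero.sqrt

theorem summable_of_summable_iterate (k : ℕ)
    (h : Summable fun j : ℕ => ‖g^[j] (g^[k] x) - a‖ ^ 2) :
    Summable fun j : ℕ => ‖g^[j] x - a‖ ^ 2 := by
  refine (summable_nat_add_iff k).1 ?_
  simpa only [Function.iterate_add_apply] using h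

theorem lyapunov_eq_sum_add (h : Summable fun k : ℕ => ‖g^[k] x - a‖ ^ 2) (N : ℕ) :
    lyapunov g a x = ∑ k ∈ Finset.range N, ‖g^[k] x - a‖ ^ 2 + lyapunov g a (g^[N] x) := by
  simp only [lyapunov, ← Function.iterate_add_apply]
  exact (h.sum_add_tsum_nat_add N).symm

theorem lyapunov_apply_sub (h : Summable fun k : ℕ => ‖g^[k] x - a‖ ^ 2) :
    lyapunov g a (g x) - lyapunov g a x = -‖x - a‖ ^ 2 := by
  rw [lyapunov_eq_sum_add h 1]
  simp

theorem lyapunov_nonneg : 0 ≤ lyapunov g a x :=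
  tsum_nonneg fun _ => sq_nonneg _

theorem lyapunov_of_isFixedPt (h : Function.IsFixedPt g a) : lyapunov g a a = 0 := by
  simp [lyapunov, Function.iterate_fixed h]

theorem exists_pos_forall_le_norm_iterate_sub (hnhds : basin Ω g a ∈ 𝓝 a) (hx : x ∈ Ω)
    (hxb : x ∉ basin Ω g a) : ∃ r > 0, ∀ k : ℕ, r ≤ ‖g^[k] x - a‖ := by
  obtain ⟨r, hr, hball⟩ := Metric.mem_nhds_iff.1 hnhds
  refine ⟨r, hr, fun k => ?_⟩
  by_contra! h
  exact hxb (mem_basin_of_iterate_mem_basin hx (hball (mem_ball_iff_norm.2 h)))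

theorem tendsto_lyapunov_nhdsWithin_basin (hgc : ContinuousOn g Ω) (hg : MapsTo g Ω Ω)
    (hnhds : basin Ω g a ∈ 𝓝 a)
    (hsum : ∀ x ∈ basin Ω g a, Summable fun k : ℕ => ‖g^[k] x - a‖ ^ 2)
    (hx : x ∈ Ω) (hxb : x ∉ basin Ω g a) :
    Tendsto (lyapunov g a) (𝓝[basin Ω g a] x) atTop := by
  obtain ⟨r, hr, hfar⟩ := exists_pos_forall_le_norm_iterate_sub hnhds hx hxb
  refine tendsto_atTop.2 fun M => ?_
  obtain ⟨N, hN⟩ := exists_nat_gt (M / r ^ 2)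
  have hcont : ContinuousOn (fun y => ∑ k ∈ Finset.range N, ‖g^[k] y - a‖ ^ 2) Ω :=
    continuousOn_finsetSum _ fun k _ => ((hgc.iterate hg k).sub continuousOn_const).norm.pow 2
  have hM : M < ∑ k ∈ Finset.range N, ‖g^[k] x - a‖ ^ 2 :=
    calc M < ∑ _k ∈ Finset.range N, r ^ 2 := by
          simpa using (div_lt_iff₀ (by positivity)).1 hN
      _ ≤ _ := Finset.sum_le_sum fun k _ => by gcongr; exact hfar k
  have hlt := (hcont x hx).mono_left (nhdsWithin_mono x fun y hy => hy.1 : 𝓝[basin Ω g a] x ≤ _)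
  filter_upwards [hlt.eventually (lt_mem_nhds hM), self_mem_nhdsWithin] with y hy hyb
  exact hy.le.trans ((hsum y hyb).sum_le_tsum _ fun _ _ => sq_nonneg _)

end Lyapunov

section NaturalDomain

theorem notMem_closure_of_tendsto_cobounded {X Z : Type*} [TopologicalSpace X] [PseudoMetricSpace Z]
    {W : Set X} {u v : X → Z} {x : X} (hv : ContinuousAt v x)
    (hu : Tendsto u (𝓝[W] x) (Bornology.cobounded Z)) (huv : EqOn v u W) : x ∉ closure W := by
  intro hx
  have : (𝓝[W] x).NeBot := mem_closure_iff_nhdsWithin_neBot.1 hx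
  exact hu.not_tendsto (Metric.disjoint_nhds_cobounded (v x)).symm
    ((hv.tendsto.mono_left nhdsWithin_le_nhds).congr' (eventually_nhdsWithin_of_forall huv))

variable {X Z : Type*} [NormedAddCommGroup X] [NormedSpace ℝ X]
  [NormedAddCommGroup Z] [NormedSpace ℝ Z] {Ω U : Set X} {u v : X → Z} {x : X}

theorem mem_interior_eq_of_mem_closure (hv : ∀ᶠ y in 𝓝 x, AnalyticAt ℝ v y)
    (hu : ∀ᶠ y in 𝓝 x, AnalyticAt ℝ u y) (hx : x ∈ closure (interior {y | v y = u y})) :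
    x ∈ interior {y | v y = u y} := by
  obtain ⟨ρ, hρ, hball⟩ := Metric.eventually_nhds_iff_ball.1 (hv.and hu)
  obtain ⟨y, hy, hyρ⟩ := Metric.mem_closure_iff.1 hx ρ hρ
  have heq : EqOn v u (Metric.ball x ρ) :=
    AnalyticOnNhd.eqOn_of_preconnected_of_eventuallyEq (fun z hz => (hball z hz).1)
      (fun z hz => (hball z hz).2) (convex_ball x ρ).isPreconnected (Metric.mem_ball'.2 hyρ)
      (mem_interior_iff_mem_nhds.1 hy)
  exact mem_interior_iff_mem_nhds.2 (Filter.mem_of_superset (Metric.ball_mem_nhds x hρ) heq)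

/-- `U` is the natural domain of analyticity of `u` inside `Ω`: the notion `IsNaturalDomain` for
maps between arbitrary normed spaces. -/
def IsNaturalAnalyticDomain (Ω U : Set X) (u : X → Z) : Prop :=
  IsOpen U ∧ U ⊆ Ω ∧ AnalyticOnNhd ℝ u U ∧
    ∀ (U₁ U₂ : Set X) (v : X → Z), IsOpen U₁ → U₁.Nonempty → U₁ ⊆ U₂ ∩ U →
      IsOpen U₂ → IsConnected U₂ → U₂ ⊆ Ω → AnalyticOnNhd ℝ v U₂ → EqOn v u U₁ → U₂ ⊆ U

theorem isNaturalAnalyticDomain_of_tendsto_cobounded (hU : IsOpen U) (hUΩ : U ⊆ Ω)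
    (hu : AnalyticOnNhd ℝ u U)
    (hblow : ∀ x ∈ Ω \ U, Tendsto u (𝓝[U] x) (Bornology.cobounded Z)) :
    IsNaturalAnalyticDomain Ω U u := by
  refine ⟨hU, hUΩ, hu, fun U₁ U₂ v hU₁ ⟨x, hx⟩ hsub hU₂ hconn hU₂Ω hv heq => ?_⟩
  suffices U₂ ⊆ U ∩ interior {y | v y = u y} from fun y hy => (this hy).1
  refine hconn.isPreconnected.subset_of_closure_inter_subset (hU.inter isOpen_interior)
    ⟨x, (hsub hx).1, (hsub hx).2, interior_maximal heq hU₁ hx⟩ ?_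
  rintro y ⟨hyW, hy⟩
  have hyU : y ∈ U := by
    by_contra h
    exact notMem_closure_of_tendsto_cobounded (hv y hy).continuousAt
      ((hblow y ⟨hU₂Ω hy, h⟩).mono_left (nhdsWithin_mono y inter_subset_left))
      (fun z hz => interior_subset (s := {y | v y = u y}) hz.2) hyW
  exact ⟨hyU, mem_interior_eq_of_mem_closure (eventually_of_mem (hU₂.mem_nhds hy) hv)
    (eventually_of_mem (hU.mem_nhds hyU) hu) (closure_mono inter_subset_right hyW)⟩

end NaturalDomain

section Family

variable {X Y : Type*} [TopologicalSpace X] {Ω : Set X} {D : Set Y} {f : X × Y → X} {φ : Y → X}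

/-- The union over `α ∈ D` of the sets `basin Ω (f (·, α)) (φ α) × {α}`: the counterpart of `G` for
arbitrary spaces. -/
def basinFamily (Ω : Set X) (D : Set Y) (f : X × Y → X) (φ : Y → X) : Set (X × Y) :=
  ⋃ α ∈ D, basin Ω (fun x => f (x, α)) (φ α) ×ˢ {α}

theorem mem_basinFamily {q : X × Y} :
    q ∈ basinFamily Ω D f φ ↔ q.2 ∈ D ∧ q.1 ∈ basin Ω (fun x => f (x, q.2)) (φ q.2) := by
  simp [basinFamily, and_comm]

theorem basinFamily_subset_prod : basinFamily Ω D f φ ⊆ Ω ×ˢ D := fun _ hq =>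
  ⟨(mem_basinFamily.1 hq).2.1, (mem_basinFamily.1 hq).1⟩

theorem preimage_basinFamily {α : Y} (hα : α ∈ D) :
    (fun x => (x, α)) ⁻¹' basinFamily Ω D f φ = basin Ω (fun x => f (x, α)) (φ α) := by
  ext x
  simp [mem_basinFamily, hα]

theorem exists_iterate_mem_of_mem_basinFamily [TopologicalSpace Y] {q : X × Y} {S : Set (X × Y)}
    (hq : q ∈ basinFamily Ω D f φ) (hS : S ∈ 𝓝 (φ q.2, q.2)) :
    ∃ k, ((fun x => f (x, q.2))^[k] q.1, q.2) ∈ S :=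
  (((mem_basinFamily.1 hq).2.2.prodMk_nhds tendsto_const_nhds).eventually hS).exists

end Family

section ContractingFixedPoint

variable {𝕜 X Y : Type*} [RCLike 𝕜] [NormedAddCommGroup X] [NormedSpace 𝕜 X] [CompleteSpace X]
  [NormedAddCommGroup Y] [NormedSpace 𝕜 Y] [CompleteSpace Y] {f : X × Y → X} {φ : Y → X} {α₀ : Y}

theorem eventually_summable_norm_iterate_sub_sq (hf : AnalyticAt 𝕜 f (φ α₀, α₀))
    (hφ : AnalyticAt 𝕜 φ α₀) (hfix : ∀ᶠ α in 𝓝 α₀, f (φ α, α) = φ α)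
    (hcontr : ‖fderiv 𝕜 (fun x => f (x, α₀)) (φ α₀)‖ < 1) :
    ∀ᶠ q in 𝓝 (φ α₀, α₀), Summable fun k : ℕ => ‖(fun x => f (x, q.2))^[k] q.1 - φ q.2‖ ^ 2 := by
  obtain ⟨S, -, hS⟩ := exists_analyticAt_iterate_sub (p := 2) hf hφ hfix hcontr
  filter_upwards [hS] with q hq
  simpa [hq] using (lp.memℓp (S q)).summable (by simp)

theorem analyticAt_norm_sq_comp {W H : Type*} [NormedAddCommGroup W] [NormedSpace ℝ W]
    [NormedAddCommGroup H] [InnerProductSpace ℝ H] {S : W → H} {w : W} (hS : AnalyticAt ℝ S w) :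
    AnalyticAt ℝ (fun z => ‖S z‖ ^ 2) w := by
  simp only [← real_inner_self_eq_norm_sq]
  exact ((innerSL ℝ).analyticAt_bilinear _).comp₂ hS hS

theorem analyticAt_lyapunov {X : Type*} [NormedAddCommGroup X] [InnerProductSpace ℝ X]
    [CompleteSpace X] {Y : Type*} [NormedAddCommGroup Y] [NormedSpace ℝ Y] [CompleteSpace Y]
    {f : X × Y → X} {φ : Y → X} {α₀ : Y} (hf : AnalyticAt ℝ f (φ α₀, α₀))
    (hφ : AnalyticAt ℝ φ α₀) (hfix : ∀ᶠ α in 𝓝 α₀, f (φ α, α) = φ α)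
    (hcontr : ‖fderiv ℝ (fun x => f (x, α₀)) (φ α₀)‖ < 1) :
    AnalyticAt ℝ (fun q : X × Y => lyapunov (fun x => f (x, q.2)) (φ q.2) q.1) (φ α₀, α₀) := by
  obtain ⟨S, hSa, hS⟩ := exists_analyticAt_iterate_sub (p := 2) hf hφ hfix hcontr
  refine (analyticAt_norm_sq_comp hSa).congr ?_
  filter_upwards [hS] with q hq
  simpa [lyapunov, hq] using lp.norm_rpow_eq_tsum (by simp) (S q)

end ContractingFixedPoint

section Iterate

variable {𝕜 X Y : Type*} [NontriviallyNormedField 𝕜] [NormedAddCommGroup X] [NormedSpace 𝕜 X]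
  [NormedAddCommGroup Y] [NormedSpace 𝕜 Y] {Ω : Set X} {D : Set Y} {f : X × Y → X}

theorem analyticOnNhd_iterate (hf : AnalyticOnNhd 𝕜 f (Ω ×ˢ D))
    (hfΩ : ∀ α ∈ D, MapsTo (fun x => f (x, α)) Ω Ω) (k : ℕ) :
    AnalyticOnNhd 𝕜 (fun q : X × Y => (fun x => f (x, q.2))^[k] q.1) (Ω ×ˢ D) := by
  induction k with
  | zero => exact fun q _ => analyticAt_fst
  | succ k ih =>
    intro q hq
    simp only [Function.iterate_succ_apply']
    exact (hf (_, q.2) ⟨(hfΩ q.2 hq.2).iterate k hq.1, hq.2⟩).fun_comp_of_eq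
      ((ih q hq).prod analyticAt_snd) rfl

end Iterate

section ContractingPath

/-- `φ` is an analytic path, over the open parameter set `D`, of fixed points of the analytic
self-maps `f (·, α)` of the open set `Ω`, at which `‖∂ₓf (φ α, α)‖ < 1`: the setting of
`theorem2_general`. -/
structure IsContractingPath {X Y : Type*} [NormedAddCommGroup X] [NormedSpace ℝ X]
    [NormedAddCommGroup Y] [NormedSpace ℝ Y] (Ω : Set X) (D : Set Y) (f : X × Y → X)
    (φ : Y → X) : Prop where
  isOpen_domain : IsOpen Ω
  isOpen_parameters : IsOpen D
  analyticOnNhd : AnalyticOnNhd ℝ f (Ω ×ˢ D)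
  mapsTo : ∀ α ∈ D, MapsTo (fun x => f (x, α)) Ω Ω
  analyticOnNhd_path : AnalyticOnNhd ℝ φ D
  path_mem : ∀ α ∈ D, φ α ∈ Ω
  isFixedPt : ∀ α ∈ D, f (φ α, α) = φ α
  norm_fderiv_lt_one : ∀ α ∈ D, ‖fderiv ℝ (fun x => f (x, α)) (φ α)‖ < 1

namespace IsContractingPath

section Normed

variable {X Y : Type*} [NormedAddCommGroup X] [NormedSpace ℝ X] [NormedAddCommGroup Y]
  [NormedSpace ℝ Y] {Ω : Set X} {D : Set Y} {f : X × Y → X} {φ : Y → X} {α : Y}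

theorem analyticAt (h : IsContractingPath Ω D f φ) (hα : α ∈ D) : AnalyticAt ℝ f (φ α, α) :=
  h.analyticOnNhd _ ⟨h.path_mem α hα, hα⟩

theorem eventually_isFixedPt (h : IsContractingPath Ω D f φ) (hα : α ∈ D) :
    ∀ᶠ β in 𝓝 α, f (φ β, β) = φ β :=
  eventually_of_mem (h.isOpen_parameters.mem_nhds hα) h.isFixedPt

theorem continuousOn (h : IsContractingPath Ω D f φ) (hα : α ∈ D) :
    ContinuousOn (fun x => f (x, α)) Ω :=
  h.analyticOnNhd.continuousOn.comp (by fun_prop) fun _ hx => ⟨hx, hα⟩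

variable [CompleteSpace X] [CompleteSpace Y]

theorem eventually_summable (h : IsContractingPath Ω D f φ) (hα : α ∈ D) :
    ∀ᶠ q in 𝓝 (φ α, α), Summable fun k : ℕ => ‖(fun x => f (x, q.2))^[k] q.1 - φ q.2‖ ^ 2 :=
  eventually_summable_norm_iterate_sub_sq (h.analyticAt hα) (h.analyticOnNhd_path α hα)
    (h.eventually_isFixedPt hα) (h.norm_fderiv_lt_one α hα)

theorem basinFamily_mem_nhds (h : IsContractingPath Ω D f φ) (hα : α ∈ D) :
    basinFamily Ω D f φ ∈ 𝓝 (φ α, α) := by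
  filter_upwards [h.eventually_summable hα, (h.isOpen_domain.prod h.isOpen_parameters).mem_nhds
    ⟨h.path_mem α hα, hα⟩] with q hq hqm
  exact mem_basinFamily.2 ⟨hqm.2, mem_basin_of_summable hqm.1 hq⟩

theorem summable (h : IsContractingPath Ω D f φ) {q : X × Y} (hq : q ∈ basinFamily Ω D f φ) :
    Summable fun k : ℕ => ‖(fun x => f (x, q.2))^[k] q.1 - φ q.2‖ ^ 2 :=
  let ⟨_, hk⟩ := exists_iterate_mem_of_mem_basinFamily hq
    (h.eventually_summable (mem_basinFamily.1 hq).1)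
  summable_of_summable_iterate _ hk

theorem summable_of_mem_basin (h : IsContractingPath Ω D f φ) (hα : α ∈ D) {x : X}
    (hx : x ∈ basin Ω (fun x => f (x, α)) (φ α)) :
    Summable fun k : ℕ => ‖(fun x => f (x, α))^[k] x - φ α‖ ^ 2 :=
  h.summable (q := (x, α)) (mem_basinFamily.2 ⟨hα, hx⟩)

theorem isOpen_basinFamily (h : IsContractingPath Ω D f φ) : IsOpen (basinFamily Ω D f φ) := by
  refine isOpen_iff_mem_nhds.2 fun q hq => ?_
  have hqΩ : Ω ×ˢ D ∈ 𝓝 q :=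
    (h.isOpen_domain.prod h.isOpen_parameters).mem_nhds (basinFamily_subset_prod hq)
  obtain ⟨k, hk⟩ := exists_iterate_mem_of_mem_basinFamily hq
    (eventually_mem_nhds_iff.2 (h.basinFamily_mem_nhds (mem_basinFamily.1 hq).1))
  have hcont : ContinuousAt (fun q : X × Y => ((fun x => f (x, q.2))^[k] q.1, q.2)) q :=
    ((analyticOnNhd_iterate h.analyticOnNhd h.mapsTo k).continuousOn.continuousAt hqΩ).prodMk
      continuousAt_snd
  filter_upwards [hqΩ, hcont hk] with q' hq' hk'
  exact mem_basinFamily.2 ⟨hq'.2, mem_basin_of_iterate_mem_basin hq'.1 (mem_basinFamily.1 hk').2⟩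

theorem isOpen_basin (h : IsContractingPath Ω D f φ) (hα : α ∈ D) :
    IsOpen (basin Ω (fun x => f (x, α)) (φ α)) :=
  preimage_basinFamily (f := f) (φ := φ) hα ▸ h.isOpen_basinFamily.preimage (.prodMk_left α)

theorem tendsto_lyapunov_atTop (h : IsContractingPath Ω D f φ) (hα : α ∈ D) {x : X}
    (hx : x ∈ Ω \ basin Ω (fun x => f (x, α)) (φ α)) :
    Tendsto (lyapunov (fun x => f (x, α)) (φ α)) (𝓝[basin Ω (fun x => f (x, α)) (φ α)] x)
      atTop := by
  have hφα : φ α ∈ basin Ω (fun x => f (x, α)) (φ α) :=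
    (mem_basinFamily.1 (mem_of_mem_nhds (h.basinFamily_mem_nhds hα))).2
  exact tendsto_lyapunov_nhdsWithin_basin (h.continuousOn hα) (h.mapsTo α hα)
    ((h.isOpen_basin hα).mem_nhds hφα) (fun _ hy => h.summable_of_mem_basin hα hy) hx.1 hx.2

end Normed

section Hilbert

variable {X Y : Type*} [NormedAddCommGroup X] [InnerProductSpace ℝ X] [CompleteSpace X]
  [NormedAddCommGroup Y] [NormedSpace ℝ Y] [CompleteSpace Y]
  {Ω : Set X} {D : Set Y} {f : X × Y → X} {φ : Y → X} {α : Y}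

theorem analyticAt_lyapunov (h : IsContractingPath Ω D f φ) (hα : α ∈ D) :
    AnalyticAt ℝ (fun q : X × Y => lyapunov (fun x => f (x, q.2)) (φ q.2) q.1) (φ α, α) :=
  ControlSystem.analyticAt_lyapunov (h.analyticAt hα) (h.analyticOnNhd_path α hα)
    (h.eventually_isFixedPt hα) (h.norm_fderiv_lt_one α hα)

theorem analyticOnNhd_lyapunov (h : IsContractingPath Ω D f φ) :
    AnalyticOnNhd ℝ (fun q : X × Y => lyapunov (fun x => f (x, q.2)) (φ q.2) q.1)
      (basinFamily Ω D f φ) := by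
  intro q hq
  have hqm : q ∈ Ω ×ˢ D := basinFamily_subset_prod hq
  obtain ⟨N, hN⟩ := exists_iterate_mem_of_mem_basinFamily hq
    (h.analyticAt_lyapunov hqm.2).eventually_analyticAt
  have hiter := fun k => analyticOnNhd_iterate h.analyticOnNhd h.mapsTo k q hqm
  have hterm : ∀ k, AnalyticAt ℝ
      (fun q : X × Y => ‖(fun x => f (x, q.2))^[k] q.1 - φ q.2‖ ^ 2) q := fun k =>
    analyticAt_norm_sq_comp
      ((hiter k).sub ((h.analyticOnNhd_path q.2 hqm.2).fun_comp analyticAt_snd))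
  have htail : AnalyticAt ℝ (fun q : X × Y => lyapunov (fun x => f (x, q.2)) (φ q.2)
      ((fun x => f (x, q.2))^[N] q.1)) q :=
    AnalyticAt.fun_comp_of_eq hN ((hiter N).prod analyticAt_snd) rfl
  refine ((Finset.analyticAt_fun_sum (Finset.range N) fun k _ => hterm k).add htail).congr ?_
  filter_upwards [h.isOpen_basinFamily.mem_nhds hq] with q' hq'
  exact (lyapunov_eq_sum_add (h.summable hq') N).symm

theorem isNaturalAnalyticDomain (h : IsContractingPath Ω D f φ) (hα : α ∈ D) :
    IsNaturalAnalyticDomain Ω (basin Ω (fun x => f (x, α)) (φ α))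
      (lyapunov (fun x => f (x, α)) (φ α)) :=
  isNaturalAnalyticDomain_of_tendsto_cobounded (h.isOpen_basin hα) (fun _ hx => hx.1)
    (fun x hx => (h.analyticOnNhd_lyapunov (x, α) (mem_basinFamily.2 ⟨hα, hx⟩)).fun_comp_of_eq
      (analyticAt_id.prod analyticAt_const) rfl)
    fun _ hx => (h.tendsto_lyapunov_atTop hα hx).mono_right IsOrderBornology.atTop_le_cobounded

end Hilbert

end IsContractingPath

end ContractingPath

end ControlSystem

open ControlSystem in
theorem theorem2_general {X Y : Type*} [NormedAddCommGroup X] [InnerProductSpace ℝ X]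
    [CompleteSpace X] [NormedAddCommGroup Y] [NormedSpace ℝ Y] [CompleteSpace Y]
    {Ω : Set X} {D : Set Y} {f : X × Y → X} {φ : Y → X} (h : IsContractingPath Ω D f φ) :
    IsOpen (basinFamily Ω D f φ) ∧
    basinFamily Ω D f φ ⊆ Ω ×ˢ D ∧
    (∀ α ∈ D, (φ α, α) ∈ basinFamily Ω D f φ) ∧
    (∀ q ∈ basinFamily Ω D f φ,
      Summable fun k : ℕ => ‖(fun x => f (x, q.2))^[k] q.1 - φ q.2‖ ^ 2) ∧
    AnalyticOnNhd ℝ (fun q => lyapunov (fun x => f (x, q.2)) (φ q.2) q.1)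
      (basinFamily Ω D f φ) ∧
    (∀ q ∈ basinFamily Ω D f φ, 0 ≤ lyapunov (fun x => f (x, q.2)) (φ q.2) q.1) ∧
    (∀ x α, (x, α) ∈ basinFamily Ω D f φ →
      (f (x, α), α) ∈ basinFamily Ω D f φ ∧
      lyapunov (fun x => f (x, α)) (φ α) (f (x, α)) - lyapunov (fun x => f (x, α)) (φ α) x =
        -‖x - φ α‖ ^ 2) ∧
    (∀ α ∈ D, lyapunov (fun x => f (x, α)) (φ α) (φ α) = 0) ∧
    (∀ α ∈ D, IsNaturalAnalyticDomain Ω (basin Ω (fun x => f (x, α)) (φ α))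
      (lyapunov (fun x => f (x, α)) (φ α))) ∧
    (∀ α ∈ D, ∀ x₀ ∈ Ω ∩ frontier (basin Ω (fun x => f (x, α)) (φ α)),
      Tendsto (lyapunov (fun x => f (x, α)) (φ α))
        (𝓝[basin Ω (fun x => f (x, α)) (φ α)] x₀) atTop) := by
  refine ⟨h.isOpen_basinFamily, basinFamily_subset_prod,
    fun α hα => mem_of_mem_nhds (h.basinFamily_mem_nhds hα), fun q hq => h.summable hq,
    h.analyticOnNhd_lyapunov, fun _ _ => lyapunov_nonneg, fun x α hx => ?_,
    fun α hα => lyapunov_of_isFixedPt (h.isFixedPt α hα), fun α hα => h.isNaturalAnalyticDomain hα,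
    fun α hα x₀ hx₀ => h.tendsto_lyapunov_atTop hα ⟨hx₀.1, ?_⟩⟩
  · obtain ⟨hα, hxα⟩ := mem_basinFamily.1 hx
    exact ⟨mem_basinFamily.2 ⟨hα, apply_mem_basin (h.mapsTo α hα) hxα⟩,
      lyapunov_apply_sub (h.summable_of_mem_basin hα hxα)⟩
  · exact (h.isOpen_basin hα).frontier_eq.subset hx₀.2 |>.2

theorem theorem2 {n m : ℕ} (Ω : Set (ControlSystem.E n)) (D D₁ : Set (ControlSystem.E m))
    (hΩ : IsOpen Ω) (hD : IsOpen D) (hD₁ : IsOpen D₁) (hD₁D : D₁ ⊆ D)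
    (f : ControlSystem.E n × ControlSystem.E m → ControlSystem.E n)
    (hf : AnalyticOnNhd ℝ f (Ω ×ˢ D))
    (hfΩ : ∀ α ∈ D₁, ∀ x ∈ Ω, f (x, α) ∈ Ω)
    (φ : ControlSystem.E m → ControlSystem.E n)
    (hφ : ControlSystem.IsStablePath Ω D₁ f φ)
    (hcontr : ∀ α ∈ D₁, ‖fderiv ℝ (fun x => f (x, α)) (φ α)‖ < 1) :
    IsOpen (ControlSystem.G Ω D₁ f φ) ∧
    ControlSystem.G Ω D₁ f φ ⊆ Ω ×ˢ D ∧
    (∀ α ∈ D₁, (φ α, α) ∈ ControlSystem.G Ω D₁ f φ) ∧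
    (∀ p ∈ ControlSystem.G Ω D₁ f φ,
      Summable fun k : ℕ => ‖ControlSystem.iter f p.2 k p.1 - φ p.2‖ ^ 2) ∧
    AnalyticOnNhd ℝ (ControlSystem.V f φ) (ControlSystem.G Ω D₁ f φ) ∧
    (∀ p ∈ ControlSystem.G Ω D₁ f φ, 0 ≤ ControlSystem.V f φ p) ∧
    (∀ (x : ControlSystem.E n) (α : ControlSystem.E m), (x, α) ∈ ControlSystem.G Ω D₁ f φ →
      (f (x, α), α) ∈ ControlSystem.G Ω D₁ f φ ∧
      ControlSystem.V f φ (f (x, α), α) - ControlSystem.V f φ (x, α) = -‖x - φ α‖ ^ 2) ∧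
    (∀ α ∈ D₁, ControlSystem.V f φ (φ α, α) = 0) ∧
    (∀ α ∈ D₁, ControlSystem.IsNaturalDomain Ω (ControlSystem.DA Ω f α (φ α))
      (fun x => ControlSystem.V f φ (x, α))) ∧
    (∀ α ∈ D₁, ∀ x₀ ∈ Ω ∩ frontier (ControlSystem.DA Ω f α (φ α)),
      Tendsto (fun x => ControlSystem.V f φ (x, α))
        (𝓝[ControlSystem.DA Ω f α (φ α)] x₀) atTop) := by
  have h : ControlSystem.IsContractingPath Ω D₁ f φ :=
    ⟨hΩ, hD₁, hf.mono (prod_mono_right hD₁D), hfΩ, hφ.1, fun α hα => (hφ.2 α hα).1.1,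
      fun α hα => (hφ.2 α hα).1.2, hcontr⟩
  obtain ⟨hopen, hsub, hrest⟩ := theorem2_general h
  exact ⟨hopen, hsub.trans (prod_mono_right hD₁D), hrest⟩
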